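/- Let $d,q$ be integers with $0\le q\le d$, and let $\mathbb{R}^{q,d-q}$ be $\mathbb{R}^d$ with the scalar product $px=-p_1x_1-\cdots-p_qx_q+p_{q+1}x_{q+1}+\cdots+p_dx_d$; write $x^2=xx$. Let $\mu\in\mathbb{C}$ with $0<\operatorname{Re}\mu<d$. Upper signs refer to the Feynman case $\mathrm{F}$, lower signs to the anti-Feynman case $\overline{\mathrm{F}}$; powers are principal branches. Then for every $m\ge 0$ the limits $$(m^2+p^2\mp i0)^{-\mu/2}:=\lim_{\epsilon\searrow0}(m^2+p^2\mp i\epsilon)^{-\mu/2},\qquad \Big(\frac{x^2\pm i0}{4}\Big)^{\frac{\mu-d}{2}}:=\lim_{\epsilon\searrow0}\Big(\frac{x^2\pm i\epsilon}{4}\Big)^{\frac{\mu-d}{2}}$$ exist in $\mathcal{S}'(\mathbb{R}^d)$. Let $$G^{\mathrm{F}/\overline{\mathrm{F}}}_{\mu,m}(x):=\int\frac{e^{ipx}}{(m^2+p^2\mp i0)^{\mu/2}}\,\frac{dp}{(2\pi)^d}$$ (a Fourier transform in the sense of $\mathcal{S}'$) be the Feynman/anti-Feynman Bessel potential for $m>0$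 and the Feynman/anti-Feynman Riesz potential for $m=0$. Then $$G^{\mathrm{F}/\overline{\mathrm{F}}}_{\mu,0}(x)=\frac{(\pm i)^q\,\Gamma(\frac{d-\mu}{2})}{\Gamma(\frac{\mu}{2})(4\pi)^{d/2}}\Big(\frac{x^2\pm i0}{4}\Big)^{\frac{\mu-d}{2}},\qquad G^{\mathrm{F}/\overline{\mathrm{F}}}_{\mu,0}=\lim_{m\searrow0}G^{\mathrm{F}/\overline{\mathrm{F}}}_{\mu,m}\quad\text{in }\mathcal{S}'(\mathbb{R}^d).$$ -/

import Mathlib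

open Filter Topology MeasureTheory
open scoped SchwartzMap FourierTransform ENNReal

noncomputable section

namespace PseudoEuclidean

/-- The diagonal signs of the scalar product of `ℝ^{q,d-q}`: the first `q` are `-1`,
the other ones `1`. -/
def diagSign {d : ℕ} (q : ℕ) (i : Fin d) : ℝ := if (i : ℕ) < q then -1 else 1

/-- The scalar product
`p x = - p₁ x₁ - ⋯ - p_q x_q + p_{q+1} x_{q+1} + ⋯ + p_d x_d` of `ℝ^{q,d-q}`. -/
def scalarProd {d : ℕ} (q : ℕ) (p x : EuclideanSpace ℝ (Fin d)) : ℝ :=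
  ∑ i, diagSign q i * p i * x i

/-- The square `x² = x x` with respect to the scalar product of `ℝ^{q,d-q}`. -/
def sq {d : ℕ} (q : ℕ) (x : EuclideanSpace ℝ (Fin d)) : ℝ := scalarProd q x x

/-! ### Fourier transformation -/

/-- The reflection `x ↦ (-x₁, …, -x_q, x_{q+1}, …, x_d)`. -/
def reflect {d : ℕ} (q : ℕ) : EuclideanSpace ℝ (Fin d) ≃ₗᵢ[ℝ] EuclideanSpace ℝ (Fin d) :=
  LinearIsometryEquiv.piLpCongrRight 2
    (fun i : Fin d => if (i : ℕ) < q then LinearIsometryEquiv.neg ℝ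
      else LinearIsometryEquiv.refl ℝ ℝ)

theorem reflect_apply {d : ℕ} (q : ℕ) (p : EuclideanSpace ℝ (Fin d)) (i : Fin d) :
    reflect q p i = diagSign q i * p i := by
  by_cases h : (i : ℕ) < q <;> simp [reflect, diagSign, h]

/-- The change of variables `p ↦ (2π)⁻¹ (-p₁, …, -p_q, p_{q+1}, …, p_d)` that relates Mathlib's
kernel `exp (2π i ⟪x, p⟫)` to the kernel `exp (i p x)`. -/
def rescale {d : ℕ} (q : ℕ) : EuclideanSpace ℝ (Fin d) ≃L[ℝ] EuclideanSpace ℝ (Fin d) :=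
  (reflect q).toContinuousLinearEquiv.trans
    (ContinuousLinearEquiv.smulLeft (Units.mk0 ((2 * Real.pi)⁻¹ : ℝ) (by positivity)))

/-- The transformation `φ ↦ (p ↦ (2π)^{-d} ∫ exp (i p x) φ(x) dx)` of Schwartz functions, see
`fourierTest_apply`. -/
def fourierTest {d : ℕ} (q : ℕ) :
    𝓢(EuclideanSpace ℝ (Fin d), ℂ) →L[ℂ] 𝓢(EuclideanSpace ℝ (Fin d), ℂ) :=
  (((2 * Real.pi : ℂ) ^ d)⁻¹) •
    ((SchwartzMap.compCLMOfContinuousLinearEquiv ℂ (rescale q)).comp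
      (FourierTransform.fourierInvCLM ℂ 𝓢(EuclideanSpace ℝ (Fin d), ℂ)))

theorem fourierTest_apply {d : ℕ} (q : ℕ) (φ : 𝓢(EuclideanSpace ℝ (Fin d), ℂ))
    (p : EuclideanSpace ℝ (Fin d)) :
    fourierTest q φ p = ((2 * Real.pi : ℂ) ^ d)⁻¹ *
      ∫ x, Complex.exp (Complex.I * scalarProd q p x) * φ x := by
  have h : fourierTest q φ p = ((2 * Real.pi : ℂ) ^ d)⁻¹ * (𝓕⁻ φ) (rescale q p) := rfl
  rw [h, SchwartzMap.fourierInv_coe, Real.fourierInv_eq']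
  congr 1
  apply integral_congr_ae
  filter_upwards with x
  have h2 : 2 * Real.pi * inner ℝ x (rescale q p) = scalarProd q p x := by
    have h3 : rescale q p = (2 * Real.pi)⁻¹ • reflect q p := rfl
    rw [h3, inner_smul_right, ← mul_assoc, mul_inv_cancel₀ (by positivity), one_mul]
    simp only [PiLp.inner_apply, scalarProd, reflect_apply]
    exact Finset.sum_congr rfl fun i _ => by simp
  rw [smul_eq_mul, h2, mul_comm Complex.I]

/-- The Fourier transform `T ↦ ∫ exp (i p x) T(p) dp / (2π)^d` of tempered distributions on
`ℝ^{q,d-q}`, defined by duality. -/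
def fourierDist {d : ℕ} (q : ℕ) :
    𝓢'(EuclideanSpace ℝ (Fin d), ℂ) →L[ℂ] 𝓢'(EuclideanSpace ℝ (Fin d), ℂ) :=
  PointwiseConvergenceCLM.precomp ℂ (fourierTest q)

theorem fourierDist_apply {d : ℕ} (q : ℕ) (T : 𝓢'(EuclideanSpace ℝ (Fin d), ℂ))
    (φ : 𝓢(EuclideanSpace ℝ (Fin d), ℂ)) : fourierDist q T φ = T (fourierTest q φ) := rfl

/-! ### Regular distributions -/

open Classical in
/-- The regular tempered distribution `φ ↦ ∫ f(x) φ(x) dx` given by an essentially bounded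
measurable function `f` (and `0` for all other `f`). -/
def regularDist {d : ℕ} (f : EuclideanSpace ℝ (Fin d) → ℂ) :
    𝓢'(EuclideanSpace ℝ (Fin d), ℂ) :=
  if h : MemLp f ∞ (volume : Measure (EuclideanSpace ℝ (Fin d))) then
    Lp.toTemperedDistribution (h.toLp f) else 0

theorem regularDist_apply {d : ℕ} {f : EuclideanSpace ℝ (Fin d) → ℂ}
    (h : MemLp f ∞ (volume : Measure (EuclideanSpace ℝ (Fin d))))
    (φ : 𝓢(EuclideanSpace ℝ (Fin d), ℂ)) : regularDist f φ = ∫ x, f x * φ x := by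
  rw [regularDist, dif_pos h, Lp.toTemperedDistribution_apply]
  apply integral_congr_ae
  filter_upwards [h.coeFn_toLp] with x hx
  rw [hx, smul_eq_mul, mul_comm]

theorem continuous_sq {d : ℕ} (q : ℕ) :
    Continuous (sq q : EuclideanSpace ℝ (Fin d) → ℝ) := by
  unfold sq scalarProd
  fun_prop

theorem memLp_cpow {d : ℕ} {g : EuclideanSpace ℝ (Fin d) → ℝ} (hg : Continuous g) {c : ℝ}
    (hc : c ≠ 0) {r : ℂ} (hr : r.re ≤ 0) :
    MemLp (fun x => ((g x : ℂ) + c * Complex.I) ^ r) ∞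
      (volume : Measure (EuclideanSpace ℝ (Fin d))) := by
  have him : ∀ x, ((g x : ℂ) + c * Complex.I).im = c := fun x => by simp
  have hne : ∀ x, ((g x : ℂ) + c * Complex.I) ≠ 0 := fun x h => hc (by rw [← him x, h]; simp)
  have hcont : Continuous (fun x => ((g x : ℂ) + c * Complex.I) ^ r) := by
    apply Continuous.cpow (by fun_prop) continuous_const
    intro x
    exact Or.inr (by rw [him]; exact hc)
  refine memLp_top_of_bound hcont.aestronglyMeasurable
    (|c| ^ r.re * Real.exp (Real.pi * |r.im|)) (Eventually.of_forall fun x => ?_)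
  rw [Complex.norm_cpow_of_ne_zero (hne x), div_eq_mul_inv, ← Real.exp_neg]
  have h1 : |c| ≤ ‖(g x : ℂ) + c * Complex.I‖ := by
    have := Complex.abs_im_le_norm ((g x : ℂ) + c * Complex.I)
    rwa [him] at this
  have h2 : -(Complex.arg ((g x : ℂ) + c * Complex.I) * r.im) ≤ Real.pi * |r.im| := by
    refine (neg_le_abs _).trans ?_
    rw [abs_mul]
    exact mul_le_mul_of_nonneg_right (Complex.abs_arg_le_pi _) (abs_nonneg _)
  have h3 := Real.rpow_le_rpow_of_nonpos (abs_pos.mpr hc) h1 hr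
  have h4 := Real.exp_le_exp.mpr h2
  gcongr

/-! ### Bessel and Riesz potentials

The parameter `s` is `1` in the Feynman case and `-1` in the anti-Feynman case. -/

/-- The regular distribution `(m² + p² ∓ iε)^{-μ/2}`, with the principal branch of the power. -/
def symbolApprox {d : ℕ} (s : ℝ) (q : ℕ) (μ : ℂ) (m ε : ℝ) :
    𝓢'(EuclideanSpace ℝ (Fin d), ℂ) :=
  regularDist fun p => (((m ^ 2 + sq q p : ℝ) : ℂ) - s * ε * Complex.I) ^ (-μ / 2)

/-- `symbolApprox` is really given by integration of the function. -/
theorem symbolApprox_apply {d : ℕ} {s : ℝ} (hs : s = 1 ∨ s = -1) (q : ℕ) {μ : ℂ}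
    (hμ : 0 < μ.re) (m : ℝ) {ε : ℝ} (hε : 0 < ε) (φ : 𝓢(EuclideanSpace ℝ (Fin d), ℂ)) :
    symbolApprox s q μ m ε φ =
      ∫ p, (((m ^ 2 + sq q p : ℝ) : ℂ) - s * ε * Complex.I) ^ (-μ / 2) * φ p := by
  have hg : Continuous fun p : EuclideanSpace ℝ (Fin d) => m ^ 2 + sq q p :=
    continuous_const.add (continuous_sq q)
  have hc : -(s * ε) ≠ 0 := by
    rcases hs with rfl | rfl <;> simp [hε.ne']
  have hr : (-μ / 2).re ≤ 0 := by
    simp only [Complex.div_ofNat_re, Complex.neg_re]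
    linarith
  have h := memLp_cpow hg hc hr
  apply regularDist_apply
  convert h using 3 with p
  push_cast
  ring

/-- The tempered distribution `(m² + p² ∓ i0)^{-μ/2} = lim_{ε ↘ 0} (m² + p² ∓ iε)^{-μ/2}`. -/
def symbol {d : ℕ} (s : ℝ) (q : ℕ) (μ : ℂ) (m : ℝ) : 𝓢'(EuclideanSpace ℝ (Fin d), ℂ) :=
  limUnder (𝓝[>] (0 : ℝ)) fun ε => symbolApprox s q μ m ε

/-- The Feynman (`s = 1`) and anti-Feynman (`s = -1`) potentials
`G_{μ,m}(x) = ∫ exp (i p x) (m² + p² ∓ i0)^{-μ/2} dp / (2π)^d`: Bessel potentials for `m > 0`,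
Riesz potentials for `m = 0`. -/
def potential {d : ℕ} (s : ℝ) (q : ℕ) (μ : ℂ) (m : ℝ) : 𝓢'(EuclideanSpace ℝ (Fin d), ℂ) :=
  fourierDist q (symbol s q μ m)

/-- The regular distribution `((x² ± iε) / 4)^r`, with the principal branch of the power. -/
def powerApprox {d : ℕ} (s : ℝ) (q : ℕ) (r : ℂ) (ε : ℝ) : 𝓢'(EuclideanSpace ℝ (Fin d), ℂ) :=
  regularDist fun x => (((sq q x : ℂ) + s * ε * Complex.I) / 4) ^ r

/-- `powerApprox` is really given by integration of the function. -/
theorem powerApprox_apply {d : ℕ} {s : ℝ} (hs : s = 1 ∨ s = -1) (q : ℕ) {r : ℂ}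
    (hr : r.re ≤ 0) {ε : ℝ} (hε : 0 < ε) (φ : 𝓢(EuclideanSpace ℝ (Fin d), ℂ)) :
    powerApprox s q r ε φ =
      ∫ x, (((sq q x : ℂ) + s * ε * Complex.I) / 4) ^ r * φ x := by
  have hg : Continuous fun x : EuclideanSpace ℝ (Fin d) => sq q x / 4 :=
    (continuous_sq q).div_const 4
  have hc : s * ε / 4 ≠ 0 := by
    rcases hs with rfl | rfl <;> simp [hε.ne']
  have h := memLp_cpow hg hc hr
  apply regularDist_apply
  convert h using 3 with x
  push_cast
  ring

/-- The tempered distribution `((x² ± i0) / 4)^r = lim_{ε ↘ 0} ((x² ± iε) / 4)^r`. -/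
def power {d : ℕ} (s : ℝ) (q : ℕ) (r : ℂ) : 𝓢'(EuclideanSpace ℝ (Fin d), ℂ) :=
  limUnder (𝓝[>] (0 : ℝ)) fun ε => powerApprox s q r ε

/-- The position space expression
`(±i)^q Γ((d-μ)/2) / (Γ(μ/2) (4π)^{d/2}) ((x² ± i0) / 4)^{(μ-d)/2}` of the Feynman and
anti-Feynman Riesz potentials. -/
def rieszPotential {d : ℕ} (s : ℝ) (q : ℕ) (μ : ℂ) : 𝓢'(EuclideanSpace ℝ (Fin d), ℂ) :=
  ((s * Complex.I) ^ q * Complex.Gamma ((d - μ) / 2) /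
      (Complex.Gamma (μ / 2) * (4 * Real.pi : ℂ) ^ ((d : ℂ) / 2))) •
    power s q ((μ - d) / 2)

end PseudoEuclidean

end

namespace PseudoEuclidean

/-! The limits, the massless limit and the Fourier formula all come from writing a power as a
superposition of oscillating Gaussians. For η > 0 and Re a > 0 the Gamma integral gives (r -
siη)^{-a} as exp(siπa/2)/Γ(a) times ∫ t^{a-1} exp(-(η + sir)t) dt (`cpow_neg_eq_integral`). Fubini
then turns the pairing of a power of M + κx² with φ into the Mellin transform at a of t ↦ exp(-zt)
`osc q (k t) φ`, where Re z = η (`integral_cpow_neg_mul`).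

The Fourier transform sends a Gaussian with parameter ∓t to one with parameter ±1/(4t), times
t^{-d/2} and a phase depending on the signature (`osc_fourierTest`). As φ is itself a Fourier
transform, `osc q (k t) φ` is O(min(1, t^{-d/2})). For 0 < Re a < d/2 the Mellin integral therefore
converges absolutely, uniformly in Re z ≥ 0, boundary included. Dominated convergence yields the
limits ε ↘ 0 and m ↘ 0.

At m = 0 the substitution t ↦ 1/t turns the Mellin transform at μ/2 into the one at (d-μ)/2
(`oscMellin_fourierTest`), which is the pairing with the position space power. The remaining phases
multiply to (si)^q. -/

/-! ### Pairings with oscillating Gaussians -/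

/-- The pairing `∫ exp (i τ x²) φ(x) dx` of a Schwartz function with an oscillating Gaussian. -/
noncomputable def osc {d : ℕ} (q : ℕ) (τ : ℝ) (φ : 𝓢(EuclideanSpace ℝ (Fin d), ℂ)) : ℂ :=
  ∫ x, Complex.exp (Complex.I * (τ * sq q x : ℝ)) * φ x

theorem norm_exp_I_mul_ofReal (r : ℝ) : ‖Complex.exp (Complex.I * r)‖ = 1 := by
  rw [mul_comm, Complex.norm_exp_ofReal_mul_I]

theorem integrable_exp_mul {d : ℕ} (q : ℕ) (τ : ℝ) (φ : 𝓢(EuclideanSpace ℝ (Fin d), ℂ)) :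
    Integrable fun x => Complex.exp (Complex.I * (τ * sq q x : ℝ)) * φ x := by
  have hc := continuous_sq (d := d) q
  refine φ.integrable.bdd_mul (c := 1) (by fun_prop) (Eventually.of_forall fun x => ?_)
  rw [norm_exp_I_mul_ofReal]

theorem norm_osc_le {d : ℕ} (q : ℕ) (τ : ℝ) (φ : 𝓢(EuclideanSpace ℝ (Fin d), ℂ)) :
    ‖osc q τ φ‖ ≤ ∫ x, ‖φ x‖ := by
  refine (norm_integral_le_integral_norm _).trans (le_of_eq ?_)
  simp only [norm_mul, norm_exp_I_mul_ofReal, one_mul]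

theorem osc_add {d : ℕ} (q : ℕ) (τ : ℝ) (φ ψ : 𝓢(EuclideanSpace ℝ (Fin d), ℂ)) :
    osc q τ (φ + ψ) = osc q τ φ + osc q τ ψ := by
  simp only [osc, add_apply, mul_add]
  exact integral_add (integrable_exp_mul q τ φ) (integrable_exp_mul q τ ψ)

theorem osc_smul {d : ℕ} (q : ℕ) (τ : ℝ) (c : ℂ) (φ : 𝓢(EuclideanSpace ℝ (Fin d), ℂ)) :
    osc q τ (c • φ) = c * osc q τ φ := by
  simp only [osc, smul_apply, smul_eq_mul, ← integral_const_mul]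
  congr 1 with x
  ring

theorem continuous_osc {d : ℕ} (q : ℕ) (φ : 𝓢(EuclideanSpace ℝ (Fin d), ℂ)) :
    Continuous fun τ => osc q τ φ := by
  have hc := continuous_sq (d := d) q
  refine continuous_of_dominated (bound := fun x => ‖φ x‖) (fun τ => ?_) (fun τ => ?_)
    φ.integrable.norm (Eventually.of_forall fun x => by fun_prop)
  · exact (integrable_exp_mul q τ φ).aestronglyMeasurable
  · exact Eventually.of_forall fun x => by rw [norm_mul, norm_exp_I_mul_ofReal, one_mul]

/-! ### The Gamma integral for complex powers -/

theorem integrableOn_cpow_mul_exp_neg_mul {a : ℂ} (ha : 0 < a.re) {z : ℂ} (hz : 0 < z.re) :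
    IntegrableOn (fun t : ℝ => (t : ℂ) ^ (a - 1) * Complex.exp (-(z * t))) (Set.Ioi 0) := by
  have h := integrableOn_rpow_mul_exp_neg_mul_rpow (p := 1) (s := a.re - 1) (b := z.re)
    (by linarith) one_pos hz
  refine Integrable.mono' h ?_ ?_
  · refine ContinuousOn.aestronglyMeasurable (fun t ht => ContinuousAt.continuousWithinAt ?_)
      measurableSet_Ioi
    exact (Complex.continuousAt_ofReal_cpow_const _ _ (Or.inr (ne_of_gt ht))).mul (by fun_prop)
  · filter_upwards [ae_restrict_mem measurableSet_Ioi] with t ht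
    rw [norm_mul, Complex.norm_cpow_eq_rpow_re_of_pos ht, Complex.norm_exp, Real.rpow_one]
    simp

/-- For real z > 0 this is the classical Gamma integral. Both sides are holomorphic in the right
half-plane, so the identity theorem extends it. -/
theorem integral_cpow_mul_exp_neg_mul {a : ℂ} (ha : 0 < a.re) {z : ℂ} (hz : 0 < z.re) :
    ∫ t in Set.Ioi (0 : ℝ), (t : ℂ) ^ (a - 1) * Complex.exp (-(z * t)) =
      z ^ (-a) * Complex.Gamma a := by
  have hopen : IsOpen {w : ℂ | 0 < w.re} := isOpen_lt continuous_const Complex.continuous_re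
  have hmeas : ∀ (b w : ℂ), AEStronglyMeasurable
      (fun t : ℝ => (t : ℂ) ^ b * Complex.exp (-(w * t))) (volume.restrict (Set.Ioi 0)) := by
    intro b w
    refine ContinuousOn.aestronglyMeasurable (fun t ht => ContinuousAt.continuousWithinAt ?_)
      measurableSet_Ioi
    exact (Complex.continuousAt_ofReal_cpow_const _ _ (Or.inr (ne_of_gt ht))).mul (by fun_prop)
  have hF : AnalyticOnNhd ℂ (fun w : ℂ => ∫ t in Set.Ioi (0 : ℝ), (t : ℂ) ^ (a - 1) *
      Complex.exp (-(w * t))) {w : ℂ | 0 < w.re} := by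
    refine DifferentiableOn.analyticOnNhd (fun w hw => ?_) hopen
    have hw : 0 < w.re := hw
    -- On this neighbourhood the differentiated integrand is dominated by a single integrable
    -- function with decay rate Re w / 2.
    have hs : {v : ℂ | w.re / 2 < v.re} ∈ 𝓝 w :=
      (isOpen_lt continuous_const Complex.continuous_re).mem_nhds
        (show w.re / 2 < w.re by linarith)
    refine (hasDerivAt_integral_of_dominated_loc_of_deriv_le
      (F' := fun v t => -((t : ℂ) ^ a * Complex.exp (-(v * t))))
      (bound := fun t => t ^ a.re * Real.exp (-(w.re / 2) * t ^ (1 : ℝ))) hs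
      (Eventually.of_forall fun v => hmeas _ v) (integrableOn_cpow_mul_exp_neg_mul ha hw)
      (hmeas _ w).neg ?_ (integrableOn_rpow_mul_exp_neg_mul_rpow (by linarith) one_pos
        (by linarith)) ?_).2.differentiableAt.differentiableWithinAt
    · filter_upwards [ae_restrict_mem measurableSet_Ioi] with t ht v hv
      have ht' : 0 < t := ht
      have hv' : w.re / 2 < v.re := hv
      rw [norm_neg, norm_mul, Complex.norm_cpow_eq_rpow_re_of_pos ht, Complex.norm_exp,
        Real.rpow_one]
      refine mul_le_mul_of_nonneg_left (Real.exp_le_exp.mpr ?_) (by positivity)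
      simp only [Complex.neg_re, Complex.re_mul_ofReal]
      nlinarith
    · filter_upwards [ae_restrict_mem measurableSet_Ioi] with t ht v _
      have h0 : (t : ℂ) ≠ 0 := Complex.ofReal_ne_zero.mpr (ne_of_gt ht)
      have h1 : HasDerivAt (fun v : ℂ => -(v * (t : ℂ))) (-t) v := by
        simpa using! ((hasDerivAt_id v).mul_const (t : ℂ)).neg
      convert! (h1.cexp.const_mul ((t : ℂ) ^ (a - 1))) using 1
      rw [Complex.cpow_sub _ _ h0, Complex.cpow_one]
      field_simp
  have hG : AnalyticOnNhd ℂ (fun w : ℂ => w ^ (-a) * Complex.Gamma a) {w : ℂ | 0 < w.re} := by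
    refine DifferentiableOn.analyticOnNhd (fun w hw => ?_) hopen
    have : DifferentiableAt ℂ (fun w : ℂ => w ^ (-a)) w :=
      differentiableAt_id.cpow_const (Or.inl hw)
    exact (this.mul_const _).differentiableWithinAt
  have hconv : IsPreconnected {w : ℂ | 0 < w.re} :=
    (convex_halfSpace_re_gt 0).isPreconnected
  refine hF.eqOn_of_preconnected_of_frequently_eq hG hconv (z₀ := 1) (by simp) ?_ hz
  have hfreq : ∃ᶠ x : ℝ in 𝓝[≠] 1, 0 < x :=
    ((eventually_gt_nhds one_pos).filter_mono nhdsWithin_le_nhds).frequently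
  have htend : Tendsto (fun x : ℝ => (x : ℂ)) (𝓝[≠] 1) (𝓝[≠] 1) := by
    refine tendsto_nhdsWithin_iff.mpr ⟨?_, ?_⟩
    · simpa using (Complex.continuous_ofReal.tendsto 1).mono_left nhdsWithin_le_nhds
    · filter_upwards [self_mem_nhdsWithin] with x hx
      simpa using hx
  refine htend.frequently (hfreq.mono fun x hx => ?_)
  rw [Complex.integral_cpow_mul_exp_neg_mul_Ioi ha hx, one_div, Complex.inv_cpow _ _ (by
    rw [Complex.arg_ofReal_of_nonneg hx.le]; exact Real.pi_pos.ne), Complex.cpow_neg]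

/-- The base factors as (-si)z with z = η + sir in the right half-plane. The arguments ∓π/2 and arg
z add up to a value within (-π, π), so the principal power is multiplicative here and (-si)^{-a} =
exp(siπa/2). -/
theorem cpow_neg_eq_integral {s : ℝ} (hs : s = 1 ∨ s = -1) {a : ℂ} (ha : 0 < a.re) (r : ℝ)
    {η : ℝ} (hη : 0 < η) :
    ((r : ℂ) - s * η * Complex.I) ^ (-a) =
      Complex.exp (s * Complex.I * (Real.pi * a / 2)) / Complex.Gamma a *
        ∫ t in Set.Ioi (0 : ℝ), (t : ℂ) ^ (a - 1) *
          Complex.exp (-((η + s * Complex.I * r) * t)) := by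
  have hG := Complex.Gamma_ne_zero_of_re_pos ha
  set z : ℂ := η + s * Complex.I * r with hz
  have hzre : 0 < z.re := by simp [hz, hη]
  have hz0 : z ≠ 0 := fun h => by simp [h] at hzre
  rw [integral_cpow_mul_exp_neg_mul ha hzre]
  have hss : (s : ℂ) * s = 1 := by rcases hs with rfl | rfl <;> norm_num
  set w : ℂ := (s : ℂ) * -Complex.I with hw
  have hA : (r : ℂ) - s * η * Complex.I = w * z := by
    rw [hz, hw]
    linear_combination (-(r : ℂ)) * hss + (s * s * r : ℂ) * Complex.I_mul_I
  have hlog : Complex.log w = -(s * (Real.pi / 2)) * Complex.I := by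
    rcases hs with rfl | rfl <;> simp [hw, Complex.log_neg_I, Complex.log_I]
  have harg : Complex.arg w = -(s * (Real.pi / 2)) := by
    rcases hs with rfl | rfl <;> simp [hw]
  have hw0 : w ≠ 0 := by
    rcases hs with rfl | rfl <;> simp [hw]
  have hlt := abs_lt.mp (Complex.abs_arg_lt_pi_div_two_iff.mpr (Or.inl hzre))
  have hsum : Complex.arg w + Complex.arg z ∈ Set.Ioc (-Real.pi) Real.pi := by
    rw [harg]
    rcases hs with rfl | rfl <;> constructor <;> linarith [hlt.1, hlt.2]
  rw [hA, Complex.cpow_def_of_ne_zero (mul_ne_zero hw0 hz0),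
    (Complex.log_mul_eq_add_log_iff hw0 hz0).mpr hsum, add_mul, Complex.exp_add, hlog,
    ← Complex.cpow_def_of_ne_zero hz0]
  have : -(s * (Real.pi / 2)) * Complex.I * -a = s * Complex.I * (Real.pi * a / 2) := by ring
  rw [this]
  field_simp

/-! ### Fourier transforms of Gaussians -/

theorem diagSign_eq {d : ℕ} (q : ℕ) (i : Fin d) : diagSign q i = 1 ∨ diagSign q i = -1 := by
  unfold diagSign
  split_ifs <;> simp

theorem sum_diagSign {d q : ℕ} (hq : q ≤ d) : ∑ i : Fin d, diagSign q i = d - 2 * q := by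
  have h : ∀ i : Fin d, diagSign q i = 1 - 2 * (if (i : ℕ) < q then 1 else 0) := fun i => by
    unfold diagSign
    split_ifs <;> norm_num
  simp only [h, Finset.sum_sub_distrib, ← Finset.mul_sum, Finset.sum_boole, Finset.sum_const,
    Finset.card_univ, Fintype.card_fin, nsmul_eq_mul, mul_one]
  congr 2
  have h := Fin.card_filter_val_lt (n := d) (m := q)
  rw [h, min_eq_right hq]

theorem integral_gaussian_mul {d : ℕ} {b : Fin d → ℂ} (hb : ∀ i, 0 < (b i).re) (c : Fin d → ℂ) :
    ∫ p : EuclideanSpace ℝ (Fin d), Complex.exp (-∑ i, b i * (p i : ℂ) ^ 2 + ∑ i, c i * p i) =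
      ∏ i, (Real.pi / b i) ^ (1 / 2 : ℂ) * Complex.exp (c i ^ 2 / (4 * b i)) := by
  rw [← GaussianFourier.integral_cexp_neg_sum_mul_add hb,
    ← (PiLp.volume_preserving_toLp (Fin d)).integral_comp
      (MeasurableEquiv.toLp 2 (Fin d → ℝ)).measurableEmbedding]

theorem integrable_gaussian {d : ℕ} {b : Fin d → ℂ} (hb : ∀ i, 0 < (b i).re) :
    Integrable fun p : EuclideanSpace ℝ (Fin d) => Complex.exp (-∑ i, b i * (p i : ℂ) ^ 2) := by
  have h := GaussianFourier.integrable_cexp_neg_sum_mul_add hb 0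
  rw [← (PiLp.volume_preserving_toLp (Fin d)).integrable_comp_emb
      (MeasurableEquiv.toLp 2 (Fin d → ℝ)).measurableEmbedding]
  simpa [Function.comp_def] using h

/-- Fubini, legitimate since Re b_i > 0, reduces this to the Gaussian integral. The signs of the
scalar product disappear because the linear coefficients i(±x_i) enter squared. -/
theorem integral_gaussian_mul_fourierTest {d : ℕ} (q : ℕ) {b : Fin d → ℂ}
    (hb : ∀ i, 0 < (b i).re) (φ : 𝓢(EuclideanSpace ℝ (Fin d), ℂ)) :
    ∫ p : EuclideanSpace ℝ (Fin d), Complex.exp (-∑ i, b i * (p i : ℂ) ^ 2) * fourierTest q φ p =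
      ((2 * Real.pi : ℂ) ^ d)⁻¹ * ∫ x, (∏ i, (Real.pi / b i) ^ (1 / 2 : ℂ) *
        Complex.exp (-(x i : ℂ) ^ 2 / (4 * b i))) * φ x := by
  have hint : Integrable (fun z : EuclideanSpace ℝ (Fin d) × EuclideanSpace ℝ (Fin d) =>
      Complex.exp (Complex.I * scalarProd q z.1 z.2) *
        (Complex.exp (-∑ i, b i * (z.1 i : ℂ) ^ 2) * φ z.2)) (volume.prod volume) := by
    refine ((integrable_gaussian hb).mul_prod φ.integrable).bdd_mul (c := 1) ?_
      (Eventually.of_forall fun z => ?_)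
    · refine Continuous.aestronglyMeasurable ?_
      unfold scalarProd
      fun_prop
    · rw [norm_exp_I_mul_ofReal]
  have h1 : ∀ p : EuclideanSpace ℝ (Fin d),
      Complex.exp (-∑ i, b i * (p i : ℂ) ^ 2) * fourierTest q φ p =
        ((2 * Real.pi : ℂ) ^ d)⁻¹ * ∫ x, Complex.exp (Complex.I * scalarProd q p x) *
          (Complex.exp (-∑ i, b i * (p i : ℂ) ^ 2) * φ x) := fun p => by
    rw [fourierTest_apply, mul_left_comm, ← integral_const_mul]
    congr 2 with x
    ring
  simp only [h1, integral_const_mul]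
  rw [integral_integral_swap hint]
  congr 2 with x
  have h2 := integral_gaussian_mul hb (fun i => Complex.I * (diagSign q i * x i : ℝ))
  have h3 : ∀ i, (Complex.I * (diagSign q i * x i : ℝ)) ^ 2 = -(x i : ℂ) ^ 2 := fun i => by
    rcases diagSign_eq q i with h | h <;> rw [h] <;> simp [mul_pow]
  simp only [h3] at h2
  rw [← h2, ← integral_mul_const]
  congr 1 with p
  rw [← mul_assoc, ← Complex.exp_add, scalarProd, add_comm, Complex.ofReal_sum, Finset.mul_sum]
  congr 3
  refine Finset.sum_congr rfl fun i _ => ?_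
  push_cast
  ring

/-- The Fresnel phase of one coordinate. Since g = ±1, the phases of all coordinates multiply to one
exponential of the sum of the signs, which is d - 2q. -/
theorem cpow_half_pi_div {s g : ℝ} (hs : s = 1 ∨ s = -1) (hg : g = 1 ∨ g = -1) {t : ℝ}
    (ht : 0 < t) :
    ((Real.pi : ℂ) / (Complex.I * (s * t * g : ℝ))) ^ (1 / 2 : ℂ) =
      ((Real.pi / t : ℝ) : ℂ) ^ (1 / 2 : ℂ) *
        Complex.exp (-(s * Complex.I * Real.pi / 4) * g) := by
  have hpt : 0 < Real.pi / t := by positivity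
  have ht0 : (t : ℂ) ≠ 0 := Complex.ofReal_ne_zero.mpr ht.ne'
  obtain ⟨σ, hσ, hsg⟩ : ∃ σ : ℝ, (σ = 1 ∨ σ = -1) ∧ s * g = σ := by
    refine ⟨s * g, ?_, rfl⟩
    rcases hs with rfl | rfl <;> rcases hg with rfl | rfl <;> norm_num
  have h1 : (Real.pi : ℂ) / (Complex.I * (s * t * g : ℝ)) =
      ((Real.pi / t : ℝ) : ℂ) * (-(σ * Complex.I)) := by
    rw [mul_right_comm, hsg]
    have : (σ : ℂ) * σ = 1 := by rcases hσ with rfl | rfl <;> norm_num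
    have h0 : (σ : ℂ) ≠ 0 := fun h => by simp [h] at this
    push_cast
    field_simp
    linear_combination (-1 : ℂ) * this + (σ * σ : ℂ) * Complex.I_sq
  have h2 : -(s * Complex.I * Real.pi / 4) * g = (-(Complex.I * Real.pi / 4)) * (σ : ℂ) := by
    rw [← hsg]
    push_cast
    ring
  rw [h1, h2, Complex.cpow_def_of_ne_zero, Complex.cpow_def_of_ne_zero
    (Complex.ofReal_ne_zero.mpr hpt.ne'), Complex.log_ofReal_mul hpt, ← Complex.exp_add,
    Complex.ofReal_log hpt.le]
  · congr 1
    rcases hσ with rfl | rfl <;> simp [Complex.log_neg_I, Complex.log_I] <;> ring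
  · rcases hσ with rfl | rfl <;> simp
  · refine mul_ne_zero (Complex.ofReal_ne_zero.mpr hpt.ne') ?_
    rcases hσ with rfl | rfl <;> simp

theorem sq_eq_sum {d : ℕ} (q : ℕ) (x : EuclideanSpace ℝ (Fin d)) :
    sq q x = ∑ i, diagSign q i * x i ^ 2 := by
  simp only [sq, scalarProd, pow_two, mul_assoc]

theorem tendsto_integral_gaussian_mul {d : ℕ} (b : Fin d → ℝ)
    (φ : 𝓢(EuclideanSpace ℝ (Fin d), ℂ)) :
    Tendsto (fun δ : ℝ => ∫ p : EuclideanSpace ℝ (Fin d),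
        Complex.exp (-∑ i, (δ + Complex.I * b i) * (p i : ℂ) ^ 2) * φ p) (𝓝[>] 0)
      (𝓝 (∫ p : EuclideanSpace ℝ (Fin d),
        Complex.exp (-∑ i, Complex.I * b i * (p i : ℂ) ^ 2) * φ p)) := by
  refine tendsto_integral_filter_of_dominated_convergence (fun p => ‖φ p‖)
    (Eventually.of_forall fun δ => ?_) ?_ φ.integrable.norm (Eventually.of_forall fun p => ?_)
  · have := φ.continuous
    exact Continuous.aestronglyMeasurable (by fun_prop)
  · filter_upwards [self_mem_nhdsWithin] with δ hδ
    refine Eventually.of_forall fun p => ?_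
    rw [norm_mul, Complex.norm_exp]
    refine mul_le_of_le_one_left (norm_nonneg _) (Real.exp_le_one_iff.mpr ?_)
    have hδ' : 0 < δ := hδ
    rw [Complex.neg_re, Complex.re_sum, neg_nonpos]
    refine Finset.sum_nonneg fun i _ => ?_
    rw [← Complex.ofReal_pow, Complex.re_mul_ofReal]
    simp only [Complex.add_re, Complex.ofReal_re, Complex.mul_re, Complex.I_re, Complex.I_im,
      Complex.ofReal_im]
    have := sq_nonneg (p i)
    nlinarith
  · have : Continuous fun δ : ℝ =>
        Complex.exp (-∑ i, (δ + Complex.I * b i) * (p i : ℂ) ^ 2) * φ p := by fun_prop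
    simpa using (this.tendsto 0).mono_left nhdsWithin_le_nhds

/-- For b_i ≠ 0 the number π/(δ + ib_i) stays off the real axis, so its principal root is continuous
up to δ = 0. The exponentials have norm at most 1 for δ > 0. -/
theorem tendsto_integral_gaussian_inv_mul {d : ℕ} {b : Fin d → ℝ} (hb : ∀ i, b i ≠ 0)
    (φ : 𝓢(EuclideanSpace ℝ (Fin d), ℂ)) :
    Tendsto (fun δ : ℝ => ∫ x : EuclideanSpace ℝ (Fin d),
        (∏ i, (Real.pi / (δ + Complex.I * b i)) ^ (1 / 2 : ℂ) *
          Complex.exp (-(x i : ℂ) ^ 2 / (4 * (δ + Complex.I * b i)))) * φ x) (𝓝[>] 0)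
      (𝓝 (∫ x : EuclideanSpace ℝ (Fin d),
        (∏ i, (Real.pi / (Complex.I * b i)) ^ (1 / 2 : ℂ) *
          Complex.exp (-(x i : ℂ) ^ 2 / (4 * (Complex.I * b i)))) * φ x)) := by
  have hne : ∀ i (δ : ℝ), (δ : ℂ) + Complex.I * b i ≠ 0 := fun i δ h => by
    have := congrArg Complex.im h
    simp [hb i] at this
  have hcw : ∀ i, Continuous fun δ : ℝ => (Real.pi : ℂ) / (δ + Complex.I * b i) := fun i =>
    continuous_const.div (by fun_prop) (hne i)
  have him : ∀ i (δ : ℝ), ((Real.pi : ℂ) / (δ + Complex.I * b i)).im ≠ 0 := fun i δ h => by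
    rw [Complex.div_im] at h
    have hn := Complex.normSq_pos.mpr (hne i δ)
    have h2 : Real.pi * b i / Complex.normSq (δ + Complex.I * b i) = 0 := by simpa using h
    exact (div_ne_zero (mul_ne_zero Real.pi_ne_zero (hb i)) hn.ne') h2
  have hcp : ∀ i, Continuous fun δ : ℝ =>
      ((Real.pi : ℂ) / (δ + Complex.I * b i)) ^ (1 / 2 : ℂ) := fun i =>
    (hcw i).cpow continuous_const fun δ => Or.inr (him i δ)
  have hce : ∀ i (x : ℝ), Continuous fun δ : ℝ =>
      Complex.exp (-(x : ℂ) ^ 2 / (4 * (δ + Complex.I * b i))) := fun i x =>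
    (continuous_const.div (by fun_prop) fun δ => mul_ne_zero (by norm_num) (hne i δ)).cexp
  have hcn : Continuous fun δ : ℝ =>
      ∏ i, ‖((Real.pi : ℂ) / (δ + Complex.I * b i)) ^ (1 / 2 : ℂ)‖ :=
    continuous_finsetProd _ fun i _ => (hcp i).norm
  -- The product of the roots is continuous in δ, so near 0 it stays below its value at 0 plus one.
  -- This gives the dominating constant `K`.
  have hev := (hcn.tendsto 0).eventually (gt_mem_nhds (lt_add_one _))
  set K := ∏ i, ‖((Real.pi : ℂ) / (((0 : ℝ) : ℂ) + Complex.I * b i)) ^ (1 / 2 : ℂ)‖ + 1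
  refine tendsto_integral_filter_of_dominated_convergence (fun x => K * ‖φ x‖)
    (Eventually.of_forall fun δ => ?_) ?_ (φ.integrable.norm.const_mul _)
    (Eventually.of_forall fun x => ?_)
  · have := φ.continuous
    exact Continuous.aestronglyMeasurable (by fun_prop)
  · filter_upwards [self_mem_nhdsWithin, hev.filter_mono nhdsWithin_le_nhds] with δ hδ hK
    refine Eventually.of_forall fun x => ?_
    rw [norm_mul]
    refine mul_le_mul_of_nonneg_right (le_trans ?_ hK.le) (norm_nonneg _)
    rw [norm_prod]
    refine Finset.prod_le_prod (fun i _ => norm_nonneg _) fun i _ => ?_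
    rw [norm_mul]
    refine mul_le_of_le_one_right (norm_nonneg _) ?_
    rw [Complex.norm_exp, Real.exp_le_one_iff, neg_div, Complex.neg_re, neg_nonpos,
      ← Complex.ofReal_pow, div_eq_mul_inv, Complex.re_ofReal_mul, Complex.inv_re]
    refine mul_nonneg (sq_nonneg _) (div_nonneg ?_ (Complex.normSq_nonneg _))
    have hδ' : 0 < δ := hδ
    simp [hδ'.le]
  · have : Continuous fun δ : ℝ => (∏ i, (Real.pi / (δ + Complex.I * b i)) ^ (1 / 2 : ℂ) *
          Complex.exp (-(x i : ℂ) ^ 2 / (4 * (δ + Complex.I * b i)))) * φ x :=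
      (continuous_finsetProd _ fun i _ => (hcp i).mul (hce i _)).mul continuous_const
    simpa using (this.tendsto 0).mono_left nhdsWithin_le_nhds

theorem gaussian_const {t : ℝ} (ht : 0 < t) (d : ℕ) :
    ((2 * Real.pi : ℂ) ^ d)⁻¹ * ((Real.pi / t : ℝ) : ℂ) ^ ((d : ℂ) / 2) =
      ((4 * Real.pi : ℂ) ^ ((d : ℂ) / 2))⁻¹ * (t : ℂ) ^ (-(d : ℂ) / 2) := by
  have hpi := Real.pi_pos
  have h4 : (4 * Real.pi : ℂ) = ((4 * Real.pi : ℝ) : ℂ) := by push_cast; rfl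
  have h1 : (2 * Real.pi : ℂ) ^ d =
      ((4 * Real.pi : ℝ) : ℂ) ^ ((d : ℂ) / 2) * ((Real.pi : ℝ) : ℂ) ^ ((d : ℂ) / 2) := by
    rw [← Complex.mul_cpow_ofReal_nonneg (by positivity) hpi.le]
    have : ((4 * Real.pi : ℝ) : ℂ) * ((Real.pi : ℝ) : ℂ) =
        ((2 * Real.pi : ℝ) : ℂ) * ((2 * Real.pi : ℝ) : ℂ) := by push_cast; ring
    rw [this, Complex.mul_cpow_ofReal_nonneg (by positivity) (by positivity),
      ← Complex.cpow_add _ _ (Complex.ofReal_ne_zero.mpr (by positivity)), add_halves,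
      Complex.cpow_natCast]
    push_cast
    rfl
  have h2 : ((Real.pi / t : ℝ) : ℂ) ^ ((d : ℂ) / 2) =
      ((Real.pi : ℝ) : ℂ) ^ ((d : ℂ) / 2) * (t : ℂ) ^ (-(d : ℂ) / 2) := by
    rw [Complex.ofReal_div, Complex.div_cpow_ofReal_nonneg hpi.le ht.le, neg_div,
      Complex.cpow_neg, div_eq_mul_inv]
  have h3 : ((Real.pi : ℝ) : ℂ) ^ ((d : ℂ) / 2) ≠ 0 := by
    simp [Complex.cpow_eq_zero_iff, hpi.ne']
  rw [h1, h2, h4, mul_inv]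
  field_simp

/-- The coefficients ist·(±1) lie on the imaginary axis, where the Gaussian is not integrable.
Adding δ > 0 makes the absolutely convergent formula available, and both sides are continuous as δ ↘
0. -/
theorem osc_fourierTest {d q : ℕ} (hq : q ≤ d) {s : ℝ} (hs : s = 1 ∨ s = -1) {t : ℝ}
    (ht : 0 < t) (φ : 𝓢(EuclideanSpace ℝ (Fin d), ℂ)) :
    osc q (-(s * t)) (fourierTest q φ) =
      ((4 * Real.pi : ℂ) ^ ((d : ℂ) / 2))⁻¹ *
        Complex.exp (-(s * Complex.I * Real.pi / 4) * (d - 2 * q)) *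
        ((t : ℂ) ^ (-(d : ℂ) / 2) * osc q (s / 4 * t⁻¹) φ) := by
  have hs0 : s ≠ 0 := by rcases hs with rfl | rfl <;> norm_num
  have hss : (s : ℂ) * s = 1 := by rcases hs with rfl | rfl <;> norm_num
  have hg0 : ∀ i : Fin d, diagSign q i ≠ 0 := fun i => by
    rcases diagSign_eq q i with h | h <;> rw [h] <;> norm_num
  have hb : ∀ i : Fin d, s * t * diagSign q i ≠ 0 := fun i =>
    mul_ne_zero (mul_ne_zero hs0 ht.ne') (hg0 i)
  have hL := tendsto_integral_gaussian_mul (fun i => s * t * diagSign q i) (fourierTest q φ)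
  have hR := (tendsto_integral_gaussian_inv_mul hb φ).const_mul (((2 * Real.pi : ℂ) ^ d)⁻¹)
  have h := tendsto_nhds_unique (hL.congr' (by
    filter_upwards [self_mem_nhdsWithin] with δ hδ
    exact integral_gaussian_mul_fourierTest q
      (b := fun i : Fin d => δ + Complex.I * (s * t * diagSign q i : ℝ))
      (fun i => by simpa using hδ) φ)) hR
  have h1 : osc q (-(s * t)) (fourierTest q φ) = ∫ p : EuclideanSpace ℝ (Fin d),
      Complex.exp (-∑ i, Complex.I * (s * t * diagSign q i : ℝ) * (p i : ℂ) ^ 2) *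
        fourierTest q φ p := by
    unfold osc
    congr 1 with p
    rw [sq_eq_sum]
    congr 2
    push_cast
    rw [Finset.mul_sum, Finset.mul_sum, ← Finset.sum_neg_distrib]
    exact Finset.sum_congr rfl fun i _ => by ring
  have ht0 : (t : ℂ) ≠ 0 := Complex.ofReal_ne_zero.mpr ht.ne'
  have h2 : ∀ x : EuclideanSpace ℝ (Fin d),
      (∏ i, ((Real.pi : ℂ) / (Complex.I * (s * t * diagSign q i : ℝ))) ^ (1 / 2 : ℂ) *
        Complex.exp (-(x i : ℂ) ^ 2 / (4 * (Complex.I * (s * t * diagSign q i : ℝ))))) =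
      ((Real.pi / t : ℝ) : ℂ) ^ ((d : ℂ) / 2) *
        Complex.exp (-(s * Complex.I * Real.pi / 4) * (d - 2 * q)) *
        Complex.exp (Complex.I * (s / 4 * t⁻¹ * sq q x : ℝ)) := fun x => by
    rw [Finset.prod_mul_distrib, ← Complex.exp_sum,
      Finset.prod_congr rfl fun i _ => cpow_half_pi_div hs (diagSign_eq q i) ht,
      Finset.prod_mul_distrib, ← Complex.exp_sum, Finset.prod_const, ← Finset.mul_sum,
      ← Complex.ofReal_sum, sum_diagSign hq, Finset.card_univ, Fintype.card_fin,
      ← Complex.cpow_nat_mul, sq_eq_sum, Finset.mul_sum, Complex.ofReal_sum, Finset.mul_sum]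
    congr 2
    · ring_nf
    · push_cast
      rfl
    · refine Finset.sum_congr rfl fun i _ => ?_
      have hs0' : (s : ℂ) ≠ 0 := Complex.ofReal_ne_zero.mpr hs0
      have hgg : (diagSign q i : ℂ) * diagSign q i = 1 := by
        rcases diagSign_eq q i with h | h <;> rw [h] <;> norm_num
      have hg0' : (diagSign q i : ℂ) ≠ 0 := Complex.ofReal_ne_zero.mpr (hg0 i)
      push_cast
      field_simp
      rw [Complex.I_sq, pow_two (s : ℂ), hss, pow_two (diagSign q i : ℂ), hgg]
      ring
  rw [h1, h]
  simp only [h2]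
  simp only [mul_assoc, integral_const_mul]
  rw [← mul_assoc, gaussian_const ht, osc]
  simp only [mul_assoc]
  ring

/-! ### Decay of the oscillating pairings -/

/-- The inverse of `fourierTest`. -/
noncomputable def fourierTestInv {d : ℕ} (q : ℕ) :
    𝓢(EuclideanSpace ℝ (Fin d), ℂ) →L[ℂ] 𝓢(EuclideanSpace ℝ (Fin d), ℂ) :=
  ((2 * Real.pi : ℂ) ^ d) •
    ((FourierTransform.fourierCLM ℂ 𝓢(EuclideanSpace ℝ (Fin d), ℂ)).comp
      (SchwartzMap.compCLMOfContinuousLinearEquiv ℂ (rescale q).symm))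

theorem fourierTest_fourierTestInv {d : ℕ} (q : ℕ) (φ : 𝓢(EuclideanSpace ℝ (Fin d), ℂ)) :
    fourierTest q (fourierTestInv q φ) = φ := by
  have h0 : ((2 * Real.pi : ℂ) ^ d) ≠ 0 := by simp [Real.pi_ne_zero]
  have h1 : fourierTest q (fourierTestInv q φ) = ((2 * Real.pi : ℂ) ^ d)⁻¹ •
      SchwartzMap.compCLMOfContinuousLinearEquiv ℂ (rescale q)
        (FourierTransform.fourierInvCLM ℂ 𝓢(EuclideanSpace ℝ (Fin d), ℂ)
          (((2 * Real.pi : ℂ) ^ d) • 𝓕 (SchwartzMap.compCLMOfContinuousLinearEquiv ℂ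
            (rescale q).symm φ))) := rfl
  rw [h1, map_smul, map_smul, inv_smul_smul₀ h0, FourierTransform.fourierInvCLM_apply,
    FourierTransform.fourierInv_fourier_eq]
  ext x
  simp

/-- A continuous seminorm that controls the oscillating Gaussians `osc q τ φ`. -/
noncomputable def oscNorm {d : ℕ} (q : ℕ) (φ : 𝓢(EuclideanSpace ℝ (Fin d), ℂ)) : ℝ :=
  (∫ x, ‖φ x‖) + ∫ x, ‖fourierTestInv q φ x‖

theorem oscNorm_nonneg {d : ℕ} (q : ℕ) (φ : 𝓢(EuclideanSpace ℝ (Fin d), ℂ)) :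
    0 ≤ oscNorm q φ := by
  unfold oscNorm
  positivity

theorem continuous_oscNorm {d : ℕ} (q : ℕ) :
    Continuous (oscNorm q : 𝓢(EuclideanSpace ℝ (Fin d), ℂ) → ℝ) := by
  have h : ∀ φ : 𝓢(EuclideanSpace ℝ (Fin d), ℂ), oscNorm q φ =
      ‖φ.toLp 1 volume‖ + ‖(fourierTestInv q φ).toLp 1 volume‖ := fun φ => by
    rw [oscNorm, SchwartzMap.norm_toLp_one, SchwartzMap.norm_toLp_one]
  have hc : Continuous fun φ : 𝓢(EuclideanSpace ℝ (Fin d), ℂ) => φ.toLp 1 volume :=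
    SchwartzMap.continuous_toLp
  rw [funext h]
  exact hc.norm.add (hc.comp (fourierTestInv q).continuous).norm

/-- The bound 1 is the triangle inequality. The bound t^{-d/2} follows by writing φ as the Fourier
transform of another Schwartz function and applying `osc_fourierTest`, whose right side has a
bounded oscillating factor. -/
theorem exists_norm_osc_le_min {d q : ℕ} (hq : q ≤ d) {k : ℝ} (hk : k ≠ 0) :
    ∃ K : ℝ, ∀ (φ : 𝓢(EuclideanSpace ℝ (Fin d), ℂ)) (t : ℝ), 0 < t →
      ‖osc q (k * t) φ‖ ≤ K * oscNorm q φ * min 1 (t ^ (-(d : ℝ) / 2)) := by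
  obtain ⟨s, hs, hsk⟩ : ∃ s : ℝ, (s = 1 ∨ s = -1) ∧ k = -(s * |k|) := by
    rcases le_total 0 k with h | h
    · exact ⟨-1, Or.inr rfl, by rw [abs_of_nonneg h]; ring⟩
    · exact ⟨1, Or.inl rfl, by rw [abs_of_nonpos h]; ring⟩
  have hk' : 0 < |k| := abs_pos.mpr hk
  set c : ℂ := ((4 * Real.pi : ℂ) ^ ((d : ℂ) / 2))⁻¹ *
    Complex.exp (-(s * Complex.I * Real.pi / 4) * (d - 2 * q))
  have hC : 0 ≤ ‖c‖ * |k| ^ (-(d : ℝ) / 2) := by positivity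
  refine ⟨1 + ‖c‖ * |k| ^ (-(d : ℝ) / 2), fun φ t ht => ?_⟩
  have hN : (∫ x, ‖φ x‖) ≤ oscNorm q φ := le_add_of_nonneg_right (by positivity)
  have hN' : (∫ x, ‖fourierTestInv q φ x‖) ≤ oscNorm q φ := le_add_of_nonneg_left (by positivity)
  have hN0 := oscNorm_nonneg q φ
  rw [mul_min_of_nonneg _ _ (by positivity), mul_one]
  refine le_min ?_ ?_
  · refine (norm_osc_le q _ φ).trans (hN.trans ?_)
    nlinarith
  · have ht' : 0 < |k| * t := by positivity
    have h1 : k * t = -(s * (|k| * t)) := by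
      conv_lhs => rw [hsk]
      ring
    conv_lhs => rw [h1, ← fourierTest_fourierTestInv q φ]
    rw [osc_fourierTest hq hs ht']
    change ‖c * _‖ ≤ _
    rw [norm_mul c, norm_mul (_ ^ _), Complex.norm_cpow_eq_rpow_re_of_pos ht']
    have h2 : (-(d : ℂ) / 2).re = -(d : ℝ) / 2 := by simp
    rw [h2, Real.mul_rpow hk'.le ht.le]
    have h3 := (norm_osc_le q (s / 4 * (|k| * t)⁻¹) (fourierTestInv q φ)).trans hN'
    have h4 : 0 ≤ t ^ (-(d : ℝ) / 2) := by positivity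
    calc _ ≤ ‖c‖ * (|k| ^ (-(d : ℝ) / 2) * t ^ (-(d : ℝ) / 2) * oscNorm q φ) := by gcongr
      _ = (‖c‖ * |k| ^ (-(d : ℝ) / 2)) * (oscNorm q φ * t ^ (-(d : ℝ) / 2)) := by ring
      _ ≤ (1 + ‖c‖ * |k| ^ (-(d : ℝ) / 2)) * (oscNorm q φ * t ^ (-(d : ℝ) / 2)) := by
        gcongr
        linarith
      _ = _ := by ring

/-! ### Mellin transforms of the oscillating pairings -/

theorem integrableOn_rpow_mul_min {ρ D : ℝ} (hρ : 0 < ρ) (hD : ρ < D) :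
    IntegrableOn (fun t : ℝ => t ^ (ρ - 1) * min 1 (t ^ (-D))) (Set.Ioi 0) := by
  have hmeas : Measurable fun t : ℝ => t ^ (ρ - 1) * min 1 (t ^ (-D)) := by fun_prop
  rw [← Set.Ioc_union_Ioi_eq_Ioi zero_le_one]
  refine IntegrableOn.union ?_ ?_
  · have h := (intervalIntegral.intervalIntegrable_rpow' (a := 0) (b := 1)
      (show -1 < ρ - 1 by linarith)).1
    refine Integrable.mono' h hmeas.aestronglyMeasurable ?_
    filter_upwards [ae_restrict_mem measurableSet_Ioc] with t ht
    have ht0 : 0 < t := ht.1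
    rw [Real.norm_of_nonneg (by positivity)]
    exact mul_le_of_le_one_right (by positivity) (min_le_left _ _)
  · have h := integrableOn_Ioi_rpow_of_lt (show ρ - 1 + -D < -1 by linarith) one_pos
    refine Integrable.mono' h hmeas.aestronglyMeasurable ?_
    filter_upwards [ae_restrict_mem measurableSet_Ioi] with t ht
    have ht0 : 0 < t := one_pos.trans ht
    rw [Real.norm_of_nonneg (by positivity), Real.rpow_add ht0]
    exact mul_le_mul_of_nonneg_left (min_le_right _ _) (by positivity)

/-- The Mellin transform at `a` of `t ↦ exp (-z t) ∫ exp (i k t x²) φ(x) dx`. -/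
noncomputable def oscMellin {d : ℕ} (q : ℕ) (a : ℂ) (k : ℝ) (z : ℂ)
    (φ : 𝓢(EuclideanSpace ℝ (Fin d), ℂ)) : ℂ :=
  mellin (fun t => Complex.exp (-(z * t)) * osc q (k * t) φ) a

theorem aestronglyMeasurable_oscMellin {d : ℕ} (q : ℕ) (a : ℂ) (k : ℝ) (z : ℂ)
    (φ : 𝓢(EuclideanSpace ℝ (Fin d), ℂ)) :
    AEStronglyMeasurable (fun t : ℝ => (t : ℂ) ^ (a - 1) •
      (Complex.exp (-(z * t)) * osc q (k * t) φ)) (volume.restrict (Set.Ioi 0)) := by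
  have h := continuous_osc q φ
  refine ContinuousOn.aestronglyMeasurable (fun t ht => ContinuousAt.continuousWithinAt ?_)
    measurableSet_Ioi
  refine (Complex.continuousAt_ofReal_cpow_const t (a - 1) (Or.inr (ne_of_gt ht))).smul ?_
  exact Continuous.continuousAt (by fun_prop)

theorem exists_norm_oscMellin_integrand_le {d q : ℕ} (hq : q ≤ d) (a : ℂ) {k : ℝ} (hk : k ≠ 0) :
    ∃ K : ℝ, ∀ (φ : 𝓢(EuclideanSpace ℝ (Fin d), ℂ)) (z : ℂ), 0 ≤ z.re → ∀ t : ℝ, 0 < t →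
      ‖(t : ℂ) ^ (a - 1) • (Complex.exp (-(z * t)) * osc q (k * t) φ)‖ ≤
        K * oscNorm q φ * (t ^ (a.re - 1) * min 1 (t ^ (-((d : ℝ) / 2)))) := by
  obtain ⟨K, hK⟩ := exists_norm_osc_le_min hq hk
  refine ⟨K, fun φ z hz t ht => ?_⟩
  have h1 : ‖Complex.exp (-(z * t))‖ ≤ 1 := by
    rw [Complex.norm_exp, Real.exp_le_one_iff]
    simp only [Complex.neg_re, Complex.re_mul_ofReal, neg_nonpos]
    positivity
  rw [norm_smul, norm_mul, Complex.norm_cpow_eq_rpow_re_of_pos ht, ← neg_div, mul_left_comm (K * oscNorm q φ)]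
  simp only [Complex.sub_re, Complex.one_re]
  refine mul_le_mul_of_nonneg_left ?_ (by positivity)
  exact (mul_le_of_le_one_left (norm_nonneg _) h1).trans (hK φ t ht)

section

variable {d q : ℕ} {a : ℂ} {k : ℝ}

theorem mellinConvergent_osc (hq : q ≤ d) (ha : 0 < a.re) (had : a.re < d / 2) (hk : k ≠ 0)
    {z : ℂ} (hz : 0 ≤ z.re) (φ : 𝓢(EuclideanSpace ℝ (Fin d), ℂ)) :
    MellinConvergent (fun t => Complex.exp (-(z * t)) * osc q (k * t) φ) a := by
  obtain ⟨K, hK⟩ := exists_norm_oscMellin_integrand_le hq a hk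
  refine Integrable.mono' ((integrableOn_rpow_mul_min ha had).const_mul (K * oscNorm q φ))
    (aestronglyMeasurable_oscMellin q a k z φ) ?_
  filter_upwards [ae_restrict_mem measurableSet_Ioi] with t ht using hK φ z hz t ht

/-- The dominating function does not depend on z in the closed right half-plane. This serves both ε
↘ 0 and m ↘ 0, where the limit of z is purely imaginary or zero. -/
theorem tendsto_oscMellin (hq : q ≤ d) (ha : 0 < a.re) (had : a.re < d / 2) (hk : k ≠ 0)
    {ι : Type*} {l : Filter ι} [l.IsCountablyGenerated] {z : ι → ℂ} {z₀ : ℂ}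
    (hz : ∀ᶠ i in l, 0 ≤ (z i).re) (hlim : Tendsto z l (𝓝 z₀))
    (φ : 𝓢(EuclideanSpace ℝ (Fin d), ℂ)) :
    Tendsto (fun i => oscMellin q a k (z i) φ) l (𝓝 (oscMellin q a k z₀ φ)) := by
  obtain ⟨K, hK⟩ := exists_norm_oscMellin_integrand_le hq a hk
  refine tendsto_integral_filter_of_dominated_convergence
    (fun t => K * oscNorm q φ * (t ^ (a.re - 1) * min 1 (t ^ (-((d : ℝ) / 2)))))
    (Eventually.of_forall fun i => aestronglyMeasurable_oscMellin q a k (z i) φ) ?_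
    ((integrableOn_rpow_mul_min ha had).const_mul _) (Eventually.of_forall fun t => ?_)
  · filter_upwards [hz] with i hi
    filter_upwards [ae_restrict_mem measurableSet_Ioi] with t ht using hK φ _ hi t ht
  · have hc : Continuous fun w : ℂ =>
        (t : ℂ) ^ (a - 1) • (Complex.exp (-(w * t)) * osc q (k * t) φ) := by fun_prop
    exact (hc.tendsto z₀).comp hlim

/-- Linearity needs convergence of the Mellin integrals. Continuity holds at 0 because the integral
is bounded by a multiple of the continuous `oscNorm`. -/
theorem exists_oscMellin_eq (hq : q ≤ d) (ha : 0 < a.re) (had : a.re < d / 2) (hk : k ≠ 0)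
    {z : ℂ} (hz : 0 ≤ z.re) :
    ∃ T : 𝓢'(EuclideanSpace ℝ (Fin d), ℂ), ∀ φ, T φ = oscMellin q a k z φ := by
  obtain ⟨K, hK⟩ := exists_norm_oscMellin_integrand_le hq a hk
  have hconv := mellinConvergent_osc hq ha had hk hz
  let L : 𝓢(EuclideanSpace ℝ (Fin d), ℂ) →ₗ[ℂ] ℂ :=
    { toFun := oscMellin q a k z
      map_add' := fun φ ψ => by
        have h := (hasMellin_add (hconv φ) (hconv ψ)).2
        simp only [← mul_add, ← osc_add] at h
        exact h
      map_smul' := fun c φ => by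
        have h := (hasMellin_const_smul (hconv φ) c).2
        simp only [smul_eq_mul] at h
        simp only [oscMellin, osc_smul, RingHom.id_apply, smul_eq_mul, mul_left_comm _ c]
        exact h }
  have hbound : ∀ φ, ‖L φ‖ ≤ K * oscNorm q φ *
      ∫ t in Set.Ioi (0 : ℝ), t ^ (a.re - 1) * min 1 (t ^ (-((d : ℝ) / 2))) := fun φ => by
    rw [← integral_const_mul]
    refine norm_integral_le_of_norm_le ((integrableOn_rpow_mul_min ha had).const_mul _) ?_
    filter_upwards [ae_restrict_mem measurableSet_Ioi] with t ht using hK φ z hz t ht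
  have hL : Continuous L := by
    refine continuous_of_continuousAt_zero L ?_
    rw [ContinuousAt, map_zero]
    refine squeeze_zero_norm hbound ?_
    have h0 : oscNorm q (0 : 𝓢(EuclideanSpace ℝ (Fin d), ℂ)) = 0 := by simp [oscNorm]
    have h1 := (((continuous_oscNorm (d := d) q).tendsto 0).const_mul K).mul_const
      (∫ t in Set.Ioi (0 : ℝ), t ^ (a.re - 1) * min 1 (t ^ (-((d : ℝ) / 2))))
    rwa [h0, mul_zero, zero_mul] at h1
  exact ⟨⟨L, hL⟩, fun φ => rfl⟩

end

/-! ### Powers as Mellin transforms and their limits -/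

/-- The factor exp(-ηt) makes the double integral absolutely convergent, so Fubini applies for η >
0. The momentum symbol is the case M = m², κ = 1; the position space power is M = 0, κ = 1/4. -/
theorem integral_cpow_neg_mul {d : ℕ} (q : ℕ) {s : ℝ} (hs : s = 1 ∨ s = -1) {a : ℂ}
    (ha : 0 < a.re) (M κ : ℝ) {η : ℝ} (hη : 0 < η) (φ : 𝓢(EuclideanSpace ℝ (Fin d), ℂ)) :
    ∫ x, (((M + κ * sq q x : ℝ) : ℂ) - s * η * Complex.I) ^ (-a) * φ x =
      Complex.exp (s * Complex.I * (Real.pi * a / 2)) / Complex.Gamma a *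
        oscMellin q a (-(s * κ)) (η + s * Complex.I * M) φ := by
  have hηre : 0 < (η : ℂ).re := by simpa using hη
  have hint : Integrable (fun z : EuclideanSpace ℝ (Fin d) × ℝ =>
      Complex.exp (Complex.I * (-(s * (M + κ * sq q z.1) * z.2) : ℝ)) *
        (φ z.1 * ((z.2 : ℂ) ^ (a - 1) * Complex.exp (-(η * z.2)))))
      (volume.prod (volume.restrict (Set.Ioi 0))) := by
    refine (φ.integrable.mul_prod (integrableOn_cpow_mul_exp_neg_mul ha hηre)).bdd_mul (c := 1)
      ?_ (Eventually.of_forall fun z => ?_)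
    · have := continuous_sq (d := d) q
      exact Continuous.aestronglyMeasurable (by fun_prop)
    · rw [norm_exp_I_mul_ofReal]
  have h1 : ∀ x : EuclideanSpace ℝ (Fin d),
      (((M + κ * sq q x : ℝ) : ℂ) - s * η * Complex.I) ^ (-a) * φ x =
        Complex.exp (s * Complex.I * (Real.pi * a / 2)) / Complex.Gamma a *
          ∫ t in Set.Ioi (0 : ℝ), Complex.exp (Complex.I * (-(s * (M + κ * sq q x) * t) : ℝ)) *
            (φ x * ((t : ℂ) ^ (a - 1) * Complex.exp (-(η * t)))) := fun x => by
    rw [cpow_neg_eq_integral hs ha _ hη, mul_assoc, ← integral_mul_const]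
    congr 2 with t
    have : Complex.exp (-((η + s * Complex.I * (M + κ * sq q x : ℝ)) * t)) =
        Complex.exp (-(η * t)) *
          Complex.exp (Complex.I * (-(s * (M + κ * sq q x) * t) : ℝ)) := by
      rw [← Complex.exp_add]
      push_cast
      ring_nf
    rw [this]
    ring
  simp only [h1, integral_const_mul]
  rw [integral_integral_swap hint]
  unfold oscMellin mellin
  congr 2 with t
  simp only [osc, smul_eq_mul, ← integral_const_mul]
  congr 1 with x
  have : Complex.exp (Complex.I * (-(s * (M + κ * sq q x) * t) : ℝ)) * Complex.exp (-(η * t)) =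
      Complex.exp (-((η + s * Complex.I * M) * t)) *
        Complex.exp (Complex.I * (-(s * κ) * t * sq q x : ℝ)) := by
    rw [← Complex.exp_add, ← Complex.exp_add]
    push_cast
    ring_nf
  linear_combination (t : ℂ) ^ (a - 1) * φ x * this

section

variable {d q : ℕ} {s : ℝ} {μ : ℂ}

theorem symbolApprox_eq (hs : s = 1 ∨ s = -1) (hμ : 0 < μ.re) (m : ℝ) {ε : ℝ} (hε : 0 < ε)
    (φ : 𝓢(EuclideanSpace ℝ (Fin d), ℂ)) :
    symbolApprox s q μ m ε φ =
      Complex.exp (s * Complex.I * (Real.pi * (μ / 2) / 2)) / Complex.Gamma (μ / 2) *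
        oscMellin q (μ / 2) (-s) (ε + s * Complex.I * (m ^ 2 : ℝ)) φ := by
  have h := integral_cpow_neg_mul q hs (a := μ / 2) (by simpa using hμ) (m ^ 2) 1 hε φ
  rw [symbolApprox_apply hs q hμ m hε]
  simpa only [one_mul, mul_one, neg_div] using h

theorem powerApprox_eq (hs : s = 1 ∨ s = -1) (hμd : μ.re < d) {ε : ℝ} (hε : 0 < ε)
    (φ : 𝓢(EuclideanSpace ℝ (Fin d), ℂ)) :
    powerApprox s q ((μ - d) / 2) ε φ =
      Complex.exp (-s * Complex.I * (Real.pi * ((d - μ) / 2) / 2)) /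
          Complex.Gamma ((d - μ) / 2) *
        oscMellin q ((d - μ) / 2) (s / 4) (ε / 4 : ℝ) φ := by
  -- The regularisation +siε in position space has the sign opposite to that in the symbol, so the
  -- general formula is used with -s.
  have hs' : -s = 1 ∨ -s = -1 := by rcases hs with rfl | rfl <;> simp
  have ha : 0 < (((d : ℂ) - μ) / 2).re := by
    simp only [Complex.div_ofNat_re, Complex.sub_re, Complex.natCast_re]
    linarith
  have hr : ((μ - (d : ℂ)) / 2).re ≤ 0 := by
    simp only [Complex.div_ofNat_re, Complex.sub_re, Complex.natCast_re]
    linarith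
  have h := integral_cpow_neg_mul q hs' ha 0 (1 / 4) (show 0 < ε / 4 by positivity) φ
  rw [powerApprox_apply hs q hr hε]
  convert! h using 1
  · congr 1 with x
    congr 2
    · push_cast
      ring
    · ring
  · congr 2
    · push_cast
      rfl
    · ring
    · simp

theorem exists_tendsto_symbolApprox (hq : q ≤ d) (hs : s = 1 ∨ s = -1) (hμ : 0 < μ.re)
    (hμd : μ.re < d) (m : ℝ) :
    ∃ T : 𝓢'(EuclideanSpace ℝ (Fin d), ℂ),
      Tendsto (fun ε : ℝ => symbolApprox s q μ m ε) (𝓝[>] 0) (𝓝 T) ∧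
      ∀ φ, T φ = Complex.exp (s * Complex.I * (Real.pi * (μ / 2) / 2)) / Complex.Gamma (μ / 2) *
        oscMellin q (μ / 2) (-s) (s * Complex.I * (m ^ 2 : ℝ)) φ := by
  have hs0 : -s ≠ 0 := by rcases hs with rfl | rfl <;> norm_num
  have ha : 0 < (μ / 2).re := by simpa using hμ
  have had : (μ / 2).re < d / 2 := by
    simp only [Complex.div_ofNat_re]
    linarith
  obtain ⟨T, hT⟩ := exists_oscMellin_eq hq ha had hs0
    (z := s * Complex.I * (m ^ 2 : ℝ)) (le_of_eq (by simp [-Complex.ofReal_pow]))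
  refine ⟨(Complex.exp (s * Complex.I * (Real.pi * (μ / 2) / 2)) / Complex.Gamma (μ / 2)) • T,
    ?_, fun φ => by rw [← hT]; rfl⟩
  rw [PointwiseConvergenceCLM.tendsto_iff_forall_tendsto]
  intro φ
  have hlim : Tendsto (fun ε : ℝ => (ε : ℂ) + s * Complex.I * (m ^ 2 : ℝ)) (𝓝[>] 0)
      (𝓝 (s * Complex.I * (m ^ 2 : ℝ))) := by
    have hc : Continuous fun ε : ℝ => (ε : ℂ) + s * Complex.I * (m ^ 2 : ℝ) := by fun_prop
    simpa using (hc.tendsto 0).mono_left nhdsWithin_le_nhds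
  have hnn : ∀ᶠ ε : ℝ in 𝓝[>] 0, 0 ≤ ((ε : ℂ) + s * Complex.I * (m ^ 2 : ℝ)).re := by
    filter_upwards [self_mem_nhdsWithin] with ε hε
    have hε' : 0 < ε := hε
    simpa [← Complex.ofReal_pow] using hε'.le
  have h := (tendsto_oscMellin hq ha had hs0 hnn hlim φ).const_mul
    (Complex.exp (s * Complex.I * (Real.pi * (μ / 2) / 2)) / Complex.Gamma (μ / 2))
  rw [← hT] at h
  refine h.congr' ?_
  filter_upwards [self_mem_nhdsWithin] with ε hε using (symbolApprox_eq hs hμ m hε φ).symm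

theorem exists_tendsto_powerApprox (hq : q ≤ d) (hs : s = 1 ∨ s = -1) (hμ : 0 < μ.re)
    (hμd : μ.re < d) :
    ∃ T : 𝓢'(EuclideanSpace ℝ (Fin d), ℂ),
      Tendsto (fun ε : ℝ => powerApprox s q ((μ - d) / 2) ε) (𝓝[>] 0) (𝓝 T) ∧
      ∀ φ, T φ = Complex.exp (-s * Complex.I * (Real.pi * ((d - μ) / 2) / 2)) /
        Complex.Gamma ((d - μ) / 2) * oscMellin q ((d - μ) / 2) (s / 4) 0 φ := by
  have hs0 : s / 4 ≠ 0 := by rcases hs with rfl | rfl <;> norm_num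
  have ha : 0 < (((d : ℂ) - μ) / 2).re := by
    simp only [Complex.div_ofNat_re, Complex.sub_re, Complex.natCast_re]
    linarith
  have had : (((d : ℂ) - μ) / 2).re < d / 2 := by
    simp only [Complex.div_ofNat_re, Complex.sub_re, Complex.natCast_re]
    linarith
  obtain ⟨T, hT⟩ := exists_oscMellin_eq hq ha had hs0 (z := 0) le_rfl
  refine ⟨(Complex.exp (-s * Complex.I * (Real.pi * ((d - μ) / 2) / 2)) /
    Complex.Gamma ((d - μ) / 2)) • T, ?_, fun φ => by rw [← hT]; rfl⟩
  rw [PointwiseConvergenceCLM.tendsto_iff_forall_tendsto]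
  intro φ
  have hlim : Tendsto (fun ε : ℝ => ((ε / 4 : ℝ) : ℂ)) (𝓝[>] 0) (𝓝 0) := by
    have hc : Continuous fun ε : ℝ => ((ε / 4 : ℝ) : ℂ) := by fun_prop
    simpa using (hc.tendsto 0).mono_left nhdsWithin_le_nhds
  have hnn : ∀ᶠ ε : ℝ in 𝓝[>] 0, 0 ≤ ((ε / 4 : ℝ) : ℂ).re := by
    filter_upwards [self_mem_nhdsWithin] with ε hε
    have hε' : 0 < ε := hε
    rw [Complex.ofReal_re]
    positivity
  have h := (tendsto_oscMellin hq ha had hs0 hnn hlim φ).const_mul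
    (Complex.exp (-s * Complex.I * (Real.pi * ((d - μ) / 2) / 2)) / Complex.Gamma ((d - μ) / 2))
  rw [← hT] at h
  refine h.congr' ?_
  filter_upwards [self_mem_nhdsWithin] with ε hε using (powerApprox_eq hs hμd hε φ).symm

theorem tendsto_symbolApprox (hq : q ≤ d) (hs : s = 1 ∨ s = -1) (hμ : 0 < μ.re)
    (hμd : μ.re < d) (m : ℝ) :
    Tendsto (fun ε : ℝ => symbolApprox (d := d) s q μ m ε) (𝓝[>] 0) (𝓝 (symbol s q μ m)) := by
  obtain ⟨T, hT, -⟩ := exists_tendsto_symbolApprox hq hs hμ hμd m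
  exact tendsto_nhds_limUnder ⟨T, hT⟩

theorem tendsto_powerApprox (hq : q ≤ d) (hs : s = 1 ∨ s = -1) (hμ : 0 < μ.re)
    (hμd : μ.re < d) :
    Tendsto (fun ε : ℝ => powerApprox (d := d) s q ((μ - d) / 2) ε) (𝓝[>] 0)
      (𝓝 (power s q ((μ - d) / 2))) := by
  obtain ⟨T, hT, -⟩ := exists_tendsto_powerApprox hq hs hμ hμd
  exact tendsto_nhds_limUnder ⟨T, hT⟩

theorem symbol_apply (hq : q ≤ d) (hs : s = 1 ∨ s = -1) (hμ : 0 < μ.re) (hμd : μ.re < d)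
    (m : ℝ) (φ : 𝓢(EuclideanSpace ℝ (Fin d), ℂ)) :
    symbol s q μ m φ =
      Complex.exp (s * Complex.I * (Real.pi * (μ / 2) / 2)) / Complex.Gamma (μ / 2) *
        oscMellin q (μ / 2) (-s) (s * Complex.I * (m ^ 2 : ℝ)) φ := by
  obtain ⟨T, hT, hTφ⟩ := exists_tendsto_symbolApprox hq hs hμ hμd m
  rw [symbol, hT.limUnder_eq, hTφ]

theorem power_apply (hq : q ≤ d) (hs : s = 1 ∨ s = -1) (hμ : 0 < μ.re) (hμd : μ.re < d)
    (φ : 𝓢(EuclideanSpace ℝ (Fin d), ℂ)) :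
    power s q ((μ - d) / 2) φ = Complex.exp (-s * Complex.I * (Real.pi * ((d - μ) / 2) / 2)) /
        Complex.Gamma ((d - μ) / 2) * oscMellin q ((d - μ) / 2) (s / 4) 0 φ := by
  obtain ⟨T, hT, hTφ⟩ := exists_tendsto_powerApprox hq hs hμ hμd
  rw [power, hT.limUnder_eq, hTφ]

theorem tendsto_symbol_massless (hq : q ≤ d) (hs : s = 1 ∨ s = -1) (hμ : 0 < μ.re)
    (hμd : μ.re < d) :
    Tendsto (fun m : ℝ => symbol (d := d) s q μ m) (𝓝[>] 0) (𝓝 (symbol s q μ 0)) := by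
  have hs0 : -s ≠ 0 := by rcases hs with rfl | rfl <;> norm_num
  have ha : 0 < (μ / 2).re := by simpa using hμ
  have had : (μ / 2).re < d / 2 := by
    simp only [Complex.div_ofNat_re]
    linarith
  rw [PointwiseConvergenceCLM.tendsto_iff_forall_tendsto]
  intro φ
  simp only [symbol_apply hq hs hμ hμd]
  have hc : Continuous fun m : ℝ => (s : ℂ) * Complex.I * (m ^ 2 : ℝ) := by fun_prop
  refine (tendsto_oscMellin hq ha had hs0 (Eventually.of_forall fun m => ?_)
    ((hc.tendsto 0).mono_left nhdsWithin_le_nhds) φ).const_mul _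
  exact le_of_eq (by simp [-Complex.ofReal_pow])

/-! ### The position space formula -/

/-- After `osc_fourierTest`, the factor t^{-d/2} shifts the exponent to a - d/2 and the substitution
t ↦ 1/t negates it. -/
theorem oscMellin_fourierTest (hq : q ≤ d) (hs : s = 1 ∨ s = -1) (a : ℂ)
    (φ : 𝓢(EuclideanSpace ℝ (Fin d), ℂ)) :
    oscMellin q a (-s) 0 (fourierTest q φ) =
      ((4 * Real.pi : ℂ) ^ ((d : ℂ) / 2))⁻¹ *
        Complex.exp (-(s * Complex.I * Real.pi / 4) * (d - 2 * q)) *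
        oscMellin q (d / 2 - a) (s / 4) 0 φ := by
  set c : ℂ := ((4 * Real.pi : ℂ) ^ ((d : ℂ) / 2))⁻¹ *
    Complex.exp (-(s * Complex.I * Real.pi / 4) * (d - 2 * q))
  have h1 := mellin_comp_inv (fun t => osc q (s / 4 * t) φ) (a + -(d : ℂ) / 2)
  rw [← mellin_cpow_smul] at h1
  have h2 : -(a + -(d : ℂ) / 2) = d / 2 - a := by ring
  rw [h2] at h1
  simp only [oscMellin, zero_mul, neg_zero, Complex.exp_zero, one_mul]
  rw [← h1, ← smul_eq_mul, ← mellin_const_smul]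
  refine setIntegral_congr_fun measurableSet_Ioi fun t ht => ?_
  have h := osc_fourierTest hq hs ht φ
  rw [← neg_mul] at h
  simp only [h, smul_eq_mul]
  rfl

theorem potential_zero_eq_rieszPotential (hq : q ≤ d) (hs : s = 1 ∨ s = -1) (hμ : 0 < μ.re)
    (hμd : μ.re < d) : potential (d := d) s q μ 0 = rieszPotential s q μ := by
  ext φ
  have hr : rieszPotential s q μ φ = ((s * Complex.I) ^ q * Complex.Gamma ((d - μ) / 2) /
      (Complex.Gamma (μ / 2) * (4 * Real.pi : ℂ) ^ ((d : ℂ) / 2))) *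
        power s q ((μ - d) / 2) φ := rfl
  have ha : 0 < (((d : ℂ) - μ) / 2).re := by
    simp only [Complex.div_ofNat_re, Complex.sub_re, Complex.natCast_re]
    linarith
  have hG := Complex.Gamma_ne_zero_of_re_pos ha
  have hsI : (s : ℂ) * Complex.I = Complex.exp (s * Complex.I * Real.pi / 2) := by
    have h : s * Complex.I * Real.pi / 2 = s * (Real.pi / 2 * Complex.I) := by ring
    rw [h]
    rcases hs with rfl | rfl
    · simp [Complex.exp_pi_div_two_mul_I]
    · simp [Complex.exp_neg, Complex.exp_pi_div_two_mul_I]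
  rw [hr, potential, fourierDist_apply, symbol_apply hq hs hμ hμd, power_apply hq hs hμ hμd]
  have h0 : (s : ℂ) * Complex.I * ((0 : ℝ) ^ 2 : ℝ) = 0 := by simp
  have h1 : (d : ℂ) / 2 - μ / 2 = (d - μ) / 2 := by ring
  have hpow := (congrArg (· ^ q) hsI).trans (Complex.exp_nat_mul _ q).symm
  beta_reduce at hpow
  rw [h0, oscMellin_fourierTest hq hs, h1, hpow]
  -- Phase bookkeeping: μ/4 - (d - 2q)/4 = q/2 - (d - μ)/4, in units of siπ. The term q/2 is the
  -- source of (si)^q.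
  have hexp : Complex.exp (s * Complex.I * (Real.pi * (μ / 2) / 2)) *
      Complex.exp (-(s * Complex.I * Real.pi / 4) * (d - 2 * q)) =
      Complex.exp (q * (s * Complex.I * Real.pi / 2)) *
        Complex.exp (-s * Complex.I * (Real.pi * ((d - μ) / 2) / 2)) := by
    rw [← Complex.exp_add, ← Complex.exp_add]
    ring_nf
  have hcancel : Complex.Gamma ((d - μ) / 2) / Complex.Gamma ((d - μ) / 2) = 1 := div_self hG
  simp only [div_eq_mul_inv, mul_inv] at hexp hcancel ⊢
  set A := oscMellin q ((d - μ) * 2⁻¹) (s * 4⁻¹) 0 φ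
  set g := ((4 * Real.pi : ℂ) ^ ((d : ℂ) * 2⁻¹))⁻¹
  set G := (Complex.Gamma (μ * 2⁻¹))⁻¹
  linear_combination G * g * A * hexp - Complex.exp (q * (s * Complex.I * Real.pi * 2⁻¹)) *
    Complex.exp (-s * Complex.I * (Real.pi * ((d - μ) * 2⁻¹) * 2⁻¹)) * G * g * A * hcancel

end

end PseudoEuclidean

theorem mainTheorem4 (d q : ℕ) (hq : q ≤ d) (s : ℝ) (hs : s = 1 ∨ s = -1) (μ : ℂ)
    (hμ : 0 < μ.re) (hμd : μ.re < d) :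
    (∀ m : ℝ, 0 ≤ m →
      Tendsto (fun ε : ℝ => PseudoEuclidean.symbolApprox (d := d) s q μ m ε) (𝓝[>] 0)
        (𝓝 (PseudoEuclidean.symbol s q μ m))) ∧
    Tendsto (fun ε : ℝ => PseudoEuclidean.powerApprox (d := d) s q ((μ - d) / 2) ε) (𝓝[>] 0)
      (𝓝 (PseudoEuclidean.power s q ((μ - d) / 2))) ∧
    PseudoEuclidean.potential (d := d) s q μ 0 = PseudoEuclidean.rieszPotential s q μ ∧
    Tendsto (fun m : ℝ => PseudoEuclidean.potential (d := d) s q μ m) (𝓝[>] 0)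
      (𝓝 (PseudoEuclidean.potential s q μ 0)) ∧
    Tendsto (fun m : ℝ => PseudoEuclidean.potential (d := d) s q μ m) (𝓝[>] 0)
      (𝓝 (PseudoEuclidean.rieszPotential s q μ)) := by
  have hriesz := PseudoEuclidean.potential_zero_eq_rieszPotential hq hs hμ hμd
  have hlim : Tendsto (fun m : ℝ => PseudoEuclidean.potential (d := d) s q μ m) (𝓝[>] 0)
      (𝓝 (PseudoEuclidean.potential s q μ 0)) :=
    ((PseudoEuclidean.fourierDist q).continuous.tendsto _).comp
      (PseudoEuclidean.tendsto_symbol_massless hq hs hμ hμd)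
  exact ⟨fun m _ => PseudoEuclidean.tendsto_symbolApprox hq hs hμ hμd m,
    PseudoEuclidean.tendsto_powerApprox hq hs hμ hμd, hriesz, hlim, hriesz ▸ hlim⟩
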